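/- Let $T\in(0,\infty)$ and let $W=(W(t))_{t\ge 0}$ be a one-dimensional Wiener process on a probability space $(\Omega,\Sigma,\mathbb P)$. Let $C([0,T])$ be the space of continuous functions $[0,T]\to\mathbb R$ with the supremum norm and its Borel $\sigma$-field. A method $\bar X=(\bar X_n)_{n\in\mathbb N}$, $\mathbb N=\{1,2,\dots\}$, is given by partitions $0=t_{0,n}<t_{1,n}<\dots<t_{n,n}=T$ and Borel maps $\varphi_n:\mathbb R^n\to C([0,T])$, through $$\bar X_n=\varphi_n\bigl(W(t_{1,n}),\dots,W(t_{n,n})\bigr).$$ Let $\chi^{\rm noneq}$ be the class of all such methods, with $n$th error $$e_n(\bar X)=\|W-\bar X_n\|_{L^2(\Omega\times[0,T])}=\Bigl(\mathbb E\int_0^T|W(t)-\bar X_n(t)|^2\,dt\Bigr)^{1/2}\in[0,\infty].$$ Let $\bar W^{\rm eq}=(\bar W^{\rm eq}_n)_{n\in\mathbb N}\in\chi^{\rm noneq}$ be the method whose $n$th partition is $t_i=iT/n$, $i=0,\dots,n$, and whose map $\varphi_n$ sends $(y_1,\dots,y_n)$ to the continuous piecewise linear function with value $0$ at $t_0=0$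 and value $y_i$ at $t_i$, $i=1,\dots,n$. Then, for every $n\in\mathbb N$: * almost surely, for all $i=0,\dots,n-1$ and all $t\in[t_i,t_{i+1}]$, $$\bar W^{\rm eq}_n(t)=\frac{(t-t_i)\,W(t_{i+1})+(t_{i+1}-t)\,W(t_i)}{t_{i+1}-t_i};$$ * $\mathbb E\int_0^T|\bar W^{\rm eq}_n(t)|^2\,dt<\infty$; * $\displaystyle e_n(\bar W^{\rm eq})=\inf_{\bar X\in\chi^{\rm noneq}}e_n(\bar X)=\frac{T}{\sqrt6}\,n^{-1/2}.$ In particular $\bar W^{\rm eq}$ is optimal in $\chi^{\rm noneq}$. -/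

import Mathlib

open MeasureTheory ProbabilityTheory
open scoped NNReal ENNReal

noncomputable section

namespace WienerRecon

/-- A point of the real interval `[0, T]`, seen as an element of the time axis `[0, ∞)`. -/
def timePt {T : ℝ} (t : Set.Icc (0 : ℝ) T) : ℝ≥0 := ⟨t, t.2.1⟩

/-- The `n`-th member of a reconstruction method: a partition `0 = t₀ < t₁ < ⋯ < tₙ = T` and a
Borel map `φ : ℝⁿ → C([0, T])`. The topology of `C(Set.Icc 0 T, ℝ)` is that of the supremum norm. -/
structure Algorithm (T : ℝ) (n : ℕ) where
  node : Fin (n + 1) → Set.Icc (0 : ℝ) T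
  node_strictMono : StrictMono node
  node_zero : (node 0 : ℝ) = 0
  node_last : (node (Fin.last n) : ℝ) = T
  φ : (Fin n → ℝ) → C(Set.Icc (0 : ℝ) T, ℝ)
  measurable_φ : Measurable[inferInstance, borel C(Set.Icc (0 : ℝ) T, ℝ)] φ

/-- A reconstruction method is a sequence of algorithms, the `n`-th one (`n = 1, 2, …`) using `n`
evaluations of the process. -/
abbrev Method (T : ℝ) : Type := ∀ n : ℕ+, Algorithm T n

/-- Lebesgue measure on `[0, T]`. -/
def lebesgueIcc (T : ℝ) : Measure (Set.Icc (0 : ℝ) T) := (volume : Measure ℝ).comap Subtype.val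

variable {Ω : Type*}

/-- The information `(W(t₁), …, W(tₙ))` used by an algorithm. -/
def Algorithm.info {T : ℝ} {n : ℕ} (A : Algorithm T n) (W : ℝ≥0 → Ω → ℝ) (ω : Ω) : Fin n → ℝ :=
  fun i => W (timePt (A.node i.succ)) ω

/-- The approximation `φ(W(t₁), …, W(tₙ))`, a random element of `C([0, T])`. -/
def Algorithm.approx {T : ℝ} {n : ℕ} (A : Algorithm T n) (W : ℝ≥0 → Ω → ℝ) (ω : Ω) :
    C(Set.Icc (0 : ℝ) T, ℝ) :=
  A.φ (A.info W ω)

/-- The `n`-th error of a method: the norm of `W - X̄ₙ` in `L²(Ω × [0, T])`, with values in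
`[0, ∞]`. -/
def error [MeasurableSpace Ω] {T : ℝ} (P : Measure Ω) (W : ℝ≥0 → Ω → ℝ) (X : Method T) (n : ℕ+) :
    ℝ≥0∞ :=
  eLpNorm (fun p : Ω × Set.Icc (0 : ℝ) T => W (timePt p.2) p.1 - (X n).approx W p.1 p.2) 2
    (P.prod (lebesgueIcc T))

/-- The `L²(Ω × [0, T])` norm of the `n`-th approximation itself. -/
def approxNorm [MeasurableSpace Ω] {T : ℝ} (P : Measure Ω) (W : ℝ≥0 → Ω → ℝ) (X : Method T)
    (n : ℕ+) : ℝ≥0∞ :=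
  eLpNorm (fun p : Ω × Set.Icc (0 : ℝ) T => (X n).approx W p.1 p.2) 2 (P.prod (lebesgueIcc T))

/-- The equidistant node `i T / n`. -/
def eqNode (T : ℝ) (n : ℕ) (i : ℕ) : ℝ := i * T / n

/-- The linear function through `(tᵢ, a)` and `(tᵢ₊₁, b)` for the equidistant mesh. -/
def segment (T : ℝ) (n : ℕ) (i : ℕ) (a b : ℝ) (t : ℝ) : ℝ :=
  ((t - eqNode T n i) * b + (eqNode T n (i + 1) - t) * a) / (eqNode T n (i + 1) - eqNode T n i)

/-- Piecewise linear interpolation at the equidistant nodes with value `0` at `t₀ = 0` and values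
`y₁, …, yₙ` at `t₁, …, tₙ`. The intervals are taken half-open, so that every node is counted
once. -/
def interp (T : ℝ) (n : ℕ) (y : Fin n → ℝ) (t : ℝ) : ℝ :=
  ∑ i : Fin n, (Set.Ioc (eqNode T n i) (eqNode T n (i + 1))).indicator
    (segment T n i ((Fin.cons 0 y : Fin (n + 1) → ℝ) i.castSucc)
      ((Fin.cons 0 y : Fin (n + 1) → ℝ) i.succ)) t

theorem eqNode_lt {T : ℝ} (hT : 0 < T) {n : ℕ} (hn : 0 < n) {i j : ℕ} (h : i < j) :
    eqNode T n i < eqNode T n j := by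
  unfold eqNode
  have : (0 : ℝ) < n := by exact_mod_cast hn
  have : (i : ℝ) < j := by exact_mod_cast h
  gcongr

theorem eqNode_le {T : ℝ} (hT : 0 < T) {n : ℕ} (hn : 0 < n) {i j : ℕ} (h : i ≤ j) :
    eqNode T n i ≤ eqNode T n j := by
  rcases h.eq_or_lt with rfl | h
  · exact le_rfl
  · exact (eqNode_lt hT hn h).le

theorem eqNode_zero (T : ℝ) (n : ℕ) : eqNode T n 0 = 0 := by simp [eqNode]

theorem eqNode_self (T : ℝ) {n : ℕ} (hn : 0 < n) : eqNode T n n = T := by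
  have : (n : ℝ) ≠ 0 := by exact_mod_cast hn.ne'
  simp only [eqNode]
  field_simp

theorem interp_eq_of_mem_Ioc {T : ℝ} (hT : 0 < T) {n : ℕ} (hn : 0 < n) (y : Fin n → ℝ)
    (k : Fin n) {t : ℝ} (ht : t ∈ Set.Ioc (eqNode T n k) (eqNode T n (k + 1))) :
    interp T n y t = segment T n k ((Fin.cons 0 y : Fin (n + 1) → ℝ) k.castSucc)
      ((Fin.cons 0 y : Fin (n + 1) → ℝ) k.succ) t := by
  unfold interp
  rw [Finset.sum_eq_single k]
  · exact Set.indicator_of_mem ht _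
  · intro j _ hj
    apply Set.indicator_of_notMem
    rintro ⟨h1, h2⟩
    rcases lt_or_gt_of_ne hj with h | h
    · have := eqNode_le hT hn (show (j : ℕ) + 1 ≤ k from h)
      linarith [ht.1]
    · have := eqNode_le hT hn (show (k : ℕ) + 1 ≤ j from h)
      linarith [ht.2]
  · simp

/-- On each closed mesh interval the interpolation is the linear function through the two adjacent
data points. -/
theorem interp_eq {T : ℝ} (hT : 0 < T) {n : ℕ} (hn : 0 < n) (y : Fin n → ℝ)
    (k : Fin n) {t : ℝ} (ht : t ∈ Set.Icc (eqNode T n k) (eqNode T n (k + 1))) :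
    interp T n y t = segment T n k ((Fin.cons 0 y : Fin (n + 1) → ℝ) k.castSucc)
      ((Fin.cons 0 y : Fin (n + 1) → ℝ) k.succ) t := by
  rcases ht.1.eq_or_lt with h | h
  · subst h
    have hk := sub_pos.2 (eqNode_lt hT hn (Nat.lt_succ_self (k : ℕ)))
    have hR : segment T n k ((Fin.cons 0 y : Fin (n + 1) → ℝ) k.castSucc)
        ((Fin.cons 0 y : Fin (n + 1) → ℝ) k.succ) (eqNode T n k)
        = (Fin.cons 0 y : Fin (n + 1) → ℝ) k.castSucc := by
      simp only [segment, sub_self, zero_mul, zero_add]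
      exact mul_div_cancel_left₀ _ hk.ne'
    rw [hR]
    obtain ⟨k, hkn⟩ := k
    cases k with
    | zero =>
      have h0 : (Fin.castSucc ⟨0, hkn⟩ : Fin (n + 1)) = 0 := rfl
      rw [h0, Fin.cons_zero]
      unfold interp
      refine Finset.sum_eq_zero fun i _ => Set.indicator_of_notMem ?_ _
      rintro ⟨h1, -⟩
      exact absurd (eqNode_le hT hn (Nat.zero_le (i : ℕ))) (not_le.2 h1)
    | succ m =>
      have hm := eqNode_lt hT hn (Nat.lt_succ_self m)
      rw [interp_eq_of_mem_Ioc hT hn y ⟨m, by omega⟩ ⟨hm, le_rfl⟩]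
      simp only [segment, sub_self, zero_mul, add_zero]
      rw [mul_div_cancel_left₀ _ (sub_pos.2 hm).ne']
      rfl
  · exact interp_eq_of_mem_Ioc hT hn y k ⟨h, ht.2⟩

theorem continuous_interp {T : ℝ} (hT : 0 < T) {n : ℕ} (hn : 0 < n) (y : Fin n → ℝ) :
    Continuous fun t : Set.Icc (0 : ℝ) T => interp T n y t := by
  refine LocallyFinite.continuous
    (f := fun k : Fin n => {t : Set.Icc (0 : ℝ) T |
      (t : ℝ) ∈ Set.Icc (eqNode T n k) (eqNode T n (k + 1))})
    (locallyFinite_of_finite _) ?_ (fun k => isClosed_Icc.preimage continuous_subtype_val) ?_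
  · refine Set.eq_univ_of_forall fun t => Set.mem_iUnion.2 ?_
    have key : ∀ m : ℕ, m ≤ n → (t : ℝ) ≤ eqNode T n m → 0 < m → ∃ k : Fin n,
        (t : ℝ) ∈ Set.Icc (eqNode T n k) (eqNode T n (k + 1)) := by
      intro m
      induction m with
      | zero => intro _ _ h; omega
      | succ m ih =>
        intro hm ht _
        by_cases h : eqNode T n m ≤ t
        · exact ⟨⟨m, hm⟩, h, ht⟩
        · rcases Nat.eq_zero_or_pos m with rfl | hm0
          · exact absurd (by rw [eqNode_zero]; exact t.2.1) h
          · exact ih (by omega) (not_le.1 h).le hm0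
    exact key n le_rfl (by rw [eqNode_self T hn]; exact t.2.2) hn
  · intro k
    refine ContinuousOn.congr (f := fun t : Set.Icc (0 : ℝ) T =>
      segment T n k ((Fin.cons 0 y : Fin (n + 1) → ℝ) k.castSucc)
        ((Fin.cons 0 y : Fin (n + 1) → ℝ) k.succ) t) ?_ fun t ht => interp_eq hT hn y k ht
    unfold segment
    fun_prop

/-- Piecewise linear interpolation as a linear map from the data to `C([0, T])`. -/
def interpLin {T : ℝ} (hT : 0 < T) {n : ℕ} (hn : 0 < n) :
    (Fin n → ℝ) →ₗ[ℝ] C(Set.Icc (0 : ℝ) T, ℝ) where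
  toFun y := ⟨fun t => interp T n y t, continuous_interp hT hn y⟩
  map_add' x y := by
    ext t
    simp only [ContinuousMap.coe_mk, ContinuousMap.add_apply, interp, ← Finset.sum_add_distrib]
    refine Finset.sum_congr rfl fun i _ => ?_
    have h : ∀ j, (Fin.cons 0 (x + y) : Fin (n + 1) → ℝ) j
        = (Fin.cons 0 x : Fin (n + 1) → ℝ) j + (Fin.cons 0 y : Fin (n + 1) → ℝ) j := by
      intro j; refine Fin.cases ?_ (fun j => ?_) j <;> simp
    simp only [Set.indicator_apply, h, segment]
    split_ifs <;> ring
  map_smul' c y := by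
    ext t
    simp only [ContinuousMap.coe_mk, ContinuousMap.smul_apply, interp, smul_eq_mul,
      Finset.mul_sum, RingHom.id_apply]
    refine Finset.sum_congr rfl fun i _ => ?_
    have h : ∀ j, (Fin.cons 0 (c • y) : Fin (n + 1) → ℝ) j
        = c * (Fin.cons 0 y : Fin (n + 1) → ℝ) j := by
      intro j; refine Fin.cases ?_ (fun j => ?_) j <;> simp
    simp only [Set.indicator_apply, h, segment]
    split_ifs <;> ring

/-- The method `W̄^eq`: piecewise linear interpolation of the data at the equidistant nodes
`i T / n`, `i = 0, …, n`. -/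
def linearEq {T : ℝ} (hT : 0 < T) : Method T := fun n =>
  { node := fun i => ⟨eqNode T n i,
      by rw [← eqNode_zero T n]; exact eqNode_le hT n.pos (Nat.zero_le _),
      (eqNode_le hT n.pos (Nat.lt_succ_iff.1 i.2)).trans_eq (eqNode_self T n.pos)⟩
    node_strictMono := fun _ _ h => eqNode_lt hT n.pos h
    node_zero := eqNode_zero T n
    node_last := eqNode_self T n.pos
    φ := interpLin hT n.pos
    measurable_φ := by
      let _ : MeasurableSpace C(Set.Icc (0 : ℝ) T, ℝ) := borel _
      have _ : BorelSpace C(Set.Icc (0 : ℝ) T, ℝ) := ⟨rfl⟩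
      exact (LinearMap.continuous_of_finiteDimensional (interpLin hT n.pos)).measurable }

end WienerRecon

end

namespace WienerRecon

/-! Between neighbouring nodes `s < u`, `W t` is its linear interpolation plus a bridge remainder,
centred with variance `(t - s)(u - t)/(u - s)`. The remainder is uncorrelated with every node value,
hence independent of all of them by joint Gaussianity (`indepFun_bridge`). Any approximation built
from the node values, linear or not, adds to the remainder an independent term, which cannot lower
the second moment (`ofReal_integral_sq_le_lintegral_add`). Integrating over time, the squared error
is at least the sum of `(tᵢ₊₁ - tᵢ)² / 6`, which is at least `T² / (6n)` by Cauchy–Schwarz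
(`sq_div_le_sum_sq`). Linear interpolation gives equality in the first bound and equal step lengths
in the second, so the infimum is attained. -/

/-- The Brownian bridge remainder: the value at `t` minus the linear interpolation of the values at
`s` and `u`. -/
noncomputable def bridge {Ω : Type*} (B : ℝ≥0 → Ω → ℝ) (s u t : ℝ≥0) (ω : Ω) : ℝ :=
  B t ω - (((t : ℝ) - s) / (u - s) * B u ω + ((u : ℝ) - t) / (u - s) * B s ω)

/-! ### The Brownian bridge: covariances and independence. -/

section Bridge

variable {Ω : Type*} [MeasurableSpace Ω] {P : Measure Ω} {B : ℝ≥0 → Ω → ℝ} {s u t : ℝ≥0}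

theorem memLp_two_eval (hB : IsPreBrownianReal B P) (t : ℝ≥0) : MemLp (B t) 2 P :=
  (hB.isGaussianProcess.hasGaussianLaw_eval t).memLp_two

theorem memLp_two_bridge (hB : IsPreBrownianReal B P) (s u t : ℝ≥0) :
    MemLp (bridge B s u t) 2 P :=
  (memLp_two_eval hB t).sub
    (((memLp_two_eval hB u).const_mul _).add ((memLp_two_eval hB s).const_mul _))

theorem integral_bridge (hB : IsPreBrownianReal B P) (s u t : ℝ≥0) :
    ∫ ω, bridge B s u t ω ∂P = 0 := by
  have h := hB.integrable_eval
  have h2 : Integrable (fun ω => ((t : ℝ) - s) / (u - s) * B u ω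
      + ((u : ℝ) - t) / (u - s) * B s ω) P := ((h u).const_mul _).add ((h s).const_mul _)
  unfold bridge
  rw [integral_sub (h t) h2, integral_add ((h u).const_mul _) ((h s).const_mul _), integral_const_mul, integral_const_mul]
  simp [hB.integral_eval]

variable [IsProbabilityMeasure P]

theorem covariance_bridge (hB : IsPreBrownianReal B P) {X : Ω → ℝ} (hX : MemLp X 2 P)
    (s u t : ℝ≥0) :
    cov[bridge B s u t, X; P] = cov[B t, X; P]
      - (((t : ℝ) - s) / (u - s) * cov[B u, X; P] + ((u : ℝ) - t) / (u - s) * cov[B s, X; P]) := by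
  have h := memLp_two_eval hB
  have : bridge B s u t = B t - ((fun ω => ((t : ℝ) - s) / (u - s) * B u ω)
      + fun ω => ((u : ℝ) - t) / (u - s) * B s ω) := rfl
  rw [this, covariance_sub_left (h t) (((h u).const_mul _).add ((h s).const_mul _)) hX,
    covariance_add_left ((h u).const_mul _) ((h s).const_mul _) hX, covariance_const_mul_left,
    covariance_const_mul_left]

/-- For `r` outside `(s, u)` the covariance `v ↦ min v r` is affine on `[s, u]`, and linear
interpolation reproduces affine functions. -/
theorem covariance_bridge_eval (hB : IsPreBrownianReal B P) (hst : s ≤ t) (htu : t ≤ u)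
    (hsu : s < u) {r : ℝ≥0} (hr : r ≤ s ∨ u ≤ r) : cov[bridge B s u t, B r; P] = 0 := by
  have hne : (u : ℝ) - s ≠ 0 := sub_ne_zero.2 (by exact_mod_cast hsu.ne')
  rw [covariance_bridge hB (memLp_two_eval hB r)]
  simp only [hB.covariance_eval]
  rcases hr with hr | hr
  · rw [min_eq_right hr, min_eq_right (hr.trans hst), min_eq_right (hr.trans hsu.le)]
    field_simp
    ring
  · rw [min_eq_left hr, min_eq_left (htu.trans hr), min_eq_left (hsu.le.trans hr)]
    field_simp
    ring

theorem integral_bridge_sq (hB : IsPreBrownianReal B P) (hst : s ≤ t) (htu : t ≤ u)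
    (hsu : s < u) :
    ∫ ω, bridge B s u t ω ^ 2 ∂P = ((t : ℝ) - s) * (u - t) / (u - s) := by
  have hne : (u : ℝ) - s ≠ 0 := sub_ne_zero.2 (by exact_mod_cast hsu.ne')
  have hR := memLp_two_bridge hB s u t
  have h1 : cov[bridge B s u t, bridge B s u t; P] = ∫ ω, bridge B s u t ω ^ 2 ∂P := by
    rw [covariance_self hR.aemeasurable,
      variance_of_integral_eq_zero hR.aemeasurable (integral_bridge hB s u t)]
  -- The remainder is uncorrelated with `B u` and `B s`, so its variance is its covariance with `B
  -- t`.
  rw [← h1, covariance_bridge hB hR, covariance_comm (B u), covariance_comm (B s),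
    covariance_bridge_eval hB hst htu hsu (Or.inr le_rfl),
    covariance_bridge_eval hB hst htu hsu (Or.inl le_rfl), covariance_comm,
    covariance_bridge hB (memLp_two_eval hB t)]
  simp only [hB.covariance_eval, min_self, min_eq_left hst, min_eq_right htu]
  field_simp
  ring

/-- The bridge remainder on `[s, u]` is independent of the values of the process outside of the
open interval `(s, u)`. -/
theorem indepFun_bridge (hB : IsPreBrownianReal B P) (hst : s ≤ t) (htu : t ≤ u) (hsu : s < u)
    {ι : Type*} (τ : ι → ℝ≥0) (hτ : ∀ j, τ j ≤ s ∨ u ≤ τ j) :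
    IndepFun (bridge B s u t) (fun ω j => B (τ j) ω) P := by
  have key : IndepFun (fun ω (_ : Unit) => bridge B s u t ω) (fun ω j => B (τ j) ω) P := by
    refine IsGaussianProcess.indepFun_of_covariance_eq_zero (X := fun _ => bridge B s u t)
      (Y := fun j => B (τ j)) ?_ (fun _ => (memLp_two_bridge hB s u t).aemeasurable)
      (fun j => hB.aemeasurable _) (fun _ j => covariance_bridge_eval hB hst htu hsu (hτ j))
    classical
    -- Joint Gaussianity: each coordinate is a fixed linear functional of finitely many values of
    -- `B`.
    refine hB.isGaussianProcess.of_isGaussianProcess ?_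
    rintro (_ | j)
    · refine ⟨{s, u, t}, ContinuousLinearMap.proj (R := ℝ) ⟨t, by simp⟩
        - ((((t : ℝ) - s) / (u - s)) • ContinuousLinearMap.proj (R := ℝ) ⟨u, by simp⟩
          + (((u : ℝ) - t) / (u - s)) • ContinuousLinearMap.proj (R := ℝ) ⟨s, by simp⟩), ?_⟩
      intro ω
      simp [bridge]
    · exact ⟨{τ j}, ContinuousLinearMap.proj (R := ℝ) ⟨τ j, by simp⟩, fun ω => by simp⟩
  exact key.comp (φ := fun f : Unit → ℝ => f ()) (measurable_pi_apply _) measurable_id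

end Bridge

/-! ### Second moments under independent perturbations. -/

theorem lintegral_enorm_sq_eq_ofReal {Ω : Type*} [MeasurableSpace Ω] {P : Measure Ω} {R : Ω → ℝ}
    (hR : MemLp R 2 P) : ∫⁻ ω, ‖R ω‖ₑ ^ 2 ∂P = ENNReal.ofReal (∫ ω, R ω ^ 2 ∂P) := by
  rw [ofReal_integral_eq_lintegral_ofReal hR.integrable_sq (ae_of_all _ fun ω => sq_nonneg _)]
  refine lintegral_congr fun ω => ?_
  rw [← sq_abs, ENNReal.ofReal_pow (abs_nonneg _), ← Real.enorm_eq_ofReal_abs]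

/-- Adding an independent perturbation to a centered square integrable random variable does not
decrease its second moment. -/
theorem ofReal_integral_sq_le_lintegral_add {Ω : Type*} [MeasurableSpace Ω] {P : Measure Ω}
    [IsProbabilityMeasure P] {R h : Ω → ℝ} (hR : MemLp R 2 P) (hR0 : ∫ ω, R ω ∂P = 0)
    (hh : AEMeasurable h P) (hind : IndepFun R h P) :
    ENNReal.ofReal (∫ ω, R ω ^ 2 ∂P) ≤ ∫⁻ ω, ‖R ω + h ω‖ₑ ^ 2 ∂P := by
  -- Square integrability of `h` is not assumed: if the right side is finite, it follows from `h =
  -- (R + h) - R`.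
  by_cases htop : ∫⁻ ω, ‖R ω + h ω‖ₑ ^ 2 ∂P = ∞
  · simp [htop]
  have hRh : MemLp (fun ω => R ω + h ω) 2 P := by
    refine ⟨(hR.aemeasurable.add hh).aestronglyMeasurable, ?_⟩
    rw [eLpNorm_lt_top_iff_lintegral_rpow_enorm_lt_top (by norm_num) (by norm_num)]
    simpa using lt_top_iff_ne_top.2 htop
  have hh2 : MemLp h 2 P := by
    have := hRh.sub hR
    refine this.congr_norm hh.aestronglyMeasurable (ae_of_all _ fun ω => ?_)
    simp
  have hint : Integrable (fun ω => R ω * h ω) P := hR.integrable_mul hh2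
  have hprod : ∫ ω, R ω * h ω ∂P = 0 := by
    have := hind.integral_mul_eq_mul_integral hR.1 hh2.1
    rw [hR0, zero_mul] at this
    exact this
  have hexp : ∫ ω, (R ω + h ω) ^ 2 ∂P = ∫ ω, R ω ^ 2 ∂P + ∫ ω, h ω ^ 2 ∂P := by
    have : ∀ ω, (R ω + h ω) ^ 2 = R ω ^ 2 + (2 * (R ω * h ω) + h ω ^ 2) := fun ω => by ring
    simp_rw [this]
    have h2 : Integrable (fun ω => 2 * (R ω * h ω) + h ω ^ 2) P :=
      (hint.const_mul 2).add hh2.integrable_sq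
    rw [integral_add hR.integrable_sq h2,
      integral_add (hint.const_mul 2) hh2.integrable_sq, integral_const_mul, hprod]
    ring
  have hle : ∫ ω, R ω ^ 2 ∂P ≤ ∫ ω, (R ω + h ω) ^ 2 ∂P := by
    rw [hexp]
    exact le_add_of_nonneg_right (integral_nonneg fun ω => sq_nonneg _)
  exact (ENNReal.ofReal_le_ofReal hle).trans_eq (lintegral_enorm_sq_eq_ofReal hRh).symm

/-! ### Joint measurability. -/

/-- A process with almost surely continuous paths and almost everywhere measurable marginals is
jointly almost everywhere measurable. -/
theorem aemeasurable_uncurry_of_ae_continuous {Ω S : Type*} [MeasurableSpace Ω]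
    [MeasurableSpace S] {P : Measure Ω} [SFinite P] {ν : Measure S} [SFinite ν]
    {W : ℝ≥0 → Ω → ℝ} (hm : ∀ t, AEMeasurable (W t) P) (hc : ∀ᵐ ω ∂P, Continuous fun t => W t ω)
    {θ : S → ℝ≥0} (hθ : Measurable θ) :
    AEMeasurable (fun p : Ω × S => W (θ p.2) p.1) (P.prod ν) := by
  choose V hV hWV using hm
  -- Sampling on the grid of mesh `1/k` uses only countably many times, so one null set covers all
  -- discrepancies between `W` and its measurable versions `V`.
  let g : ℕ → Ω × S → ℝ := fun k p => V ((⌊(θ p.2 : ℝ) * k⌋₊ : ℝ≥0) / (k : ℝ≥0)) p.1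
  have hg : ∀ k, Measurable (g k) := by
    intro k
    have h1 : Measurable fun q : Ω × ℕ => V ((q.2 : ℝ≥0) / (k : ℝ≥0)) q.1 :=
      measurable_from_prod_countable_left fun j => hV ((j : ℝ≥0) / (k : ℝ≥0))
    have h2 : Measurable fun p : Ω × S => (p.1, ⌊(θ p.2 : ℝ) * k⌋₊) :=
      measurable_fst.prodMk
        (Nat.measurable_floor.comp ((hθ.comp measurable_snd).coe_nnreal_real.mul_const _))
    exact h1.comp h2
  refine aemeasurable_of_tendsto_metrizable_ae Filter.atTop (fun k => (hg k).aemeasurable) ?_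
  have hae : ∀ᵐ ω ∂P, ∀ k j : ℕ,
      W ((j : ℝ≥0) / (k : ℝ≥0)) ω = V ((j : ℝ≥0) / (k : ℝ≥0)) ω :=
    ae_all_iff.2 fun k => ae_all_iff.2 fun j => hWV _
  filter_upwards [Measure.quasiMeasurePreserving_fst.ae hae,
    Measure.quasiMeasurePreserving_fst.ae hc] with p hp hcp
  have hlim : Filter.Tendsto (fun k : ℕ => (⌊(θ p.2 : ℝ) * k⌋₊ : ℝ≥0) / (k : ℝ≥0)) Filter.atTop
      (nhds (θ p.2)) := by
    rw [← NNReal.tendsto_coe]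
    simpa [Function.comp_def] using (tendsto_nat_floor_mul_div_atTop (θ p.2).coe_nonneg).comp
      (tendsto_natCast_atTop_atTop (R := ℝ))
  refine ((hcp.tendsto (θ p.2)).comp hlim).congr fun k => ?_
  exact hp k _

/-! ### Integrated conditional variance and partitions. -/

theorem lintegral_Ioc_mul_sub_div {a b : ℝ} (hab : a < b) :
    ∫⁻ t in Set.Ioc a b, ENNReal.ofReal ((t - a) * (b - t) / (b - a))
      = ENNReal.ofReal ((b - a) ^ 2 / 6) := by
  have hba : b - a ≠ 0 := (sub_pos.2 hab).ne'
  have hcont : Continuous fun t : ℝ => (t - a) * (b - t) / (b - a) := by fun_prop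
  rw [← ofReal_integral_eq_lintegral_ofReal, ← intervalIntegral.integral_of_le hab.le]
  · congr 1
    -- The antiderivative comes from `(t - a)(b - t) = (t - a)(b - a) - (t - a)²`.
    have hder : ∀ t ∈ Set.uIcc a b, HasDerivAt
        (fun t : ℝ => ((t - a) ^ 2 * (b - a) / 2 - (t - a) ^ 3 / 3) / (b - a))
        ((t - a) * (b - t) / (b - a)) t := by
      intro t _
      have h := (hasDerivAt_id t).sub_const a
      refine HasDerivAt.congr_deriv (((((h.pow 2).mul_const (b - a)).div_const 2).sub
        ((h.pow 3).div_const 3)).div_const (b - a)) ?_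
      simp only [id]
      push_cast
      ring
    rw [intervalIntegral.integral_eq_sub_of_hasDerivAt hder (hcont.intervalIntegrable _ _)]
    field_simp
    ring
  · exact (hcont.integrableOn_Icc).mono_set Set.Ioc_subset_Icc_self
  · refine (ae_restrict_iff' measurableSet_Ioc).2 (ae_of_all _ fun t ht => ?_)
    exact div_nonneg (mul_nonneg (by linarith [ht.1]) (by linarith [ht.2])) (by linarith)

/-- The conditional variance at time `t` of a Wiener process given its values at the nodes of the
partition `τ`. -/
noncomputable def condVar {n : ℕ} (τ : Fin (n + 1) → ℝ) (t : ℝ) : ℝ≥0∞ :=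
  ∑ i : Fin n, (Set.Ioc (τ i.castSucc) (τ i.succ)).indicator
    (fun t => ENNReal.ofReal ((t - τ i.castSucc) * (τ i.succ - t) / (τ i.succ - τ i.castSucc))) t

theorem condVar_eq_of_mem_Ioc {n : ℕ} {τ : Fin (n + 1) → ℝ} (hτ : StrictMono τ) (k : Fin n)
    {t : ℝ} (ht : t ∈ Set.Ioc (τ k.castSucc) (τ k.succ)) :
    condVar τ t
      = ENNReal.ofReal ((t - τ k.castSucc) * (τ k.succ - t) / (τ k.succ - τ k.castSucc)) := by
  unfold condVar
  rw [Finset.sum_eq_single k]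
  · exact Set.indicator_of_mem ht _
  · intro j _ hj
    apply Set.indicator_of_notMem
    rintro ⟨h1, h2⟩
    rcases lt_or_gt_of_ne hj with h | h
    · have := hτ.monotone (show j.succ ≤ k.castSucc from h)
      linarith [ht.1]
    · have := hτ.monotone (show k.succ ≤ j.castSucc from h)
      linarith [ht.2]
  · simp

theorem exists_mem_Ioc {n : ℕ} (τ : Fin (n + 1) → ℝ) {t : ℝ} (h0 : τ 0 < t)
    (hn : t ≤ τ (Fin.last n)) : ∃ k : Fin n, t ∈ Set.Ioc (τ k.castSucc) (τ k.succ) := by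
  by_contra! h
  have key : ∀ i : Fin (n + 1), τ i < t := by
    intro i
    induction i using Fin.induction with
    | zero => exact h0
    | succ k ih => exact lt_of_not_ge fun hle => h k ⟨ih, hle⟩
  exact absurd hn (not_le.2 (key _))

theorem lintegral_condVar {T : ℝ} {n : ℕ} {τ : Fin (n + 1) → ℝ} (hτ : StrictMono τ)
    (h0 : τ 0 = 0) (hn : τ (Fin.last n) = T) :
    ∫⁻ t : Set.Icc (0 : ℝ) T, condVar τ t ∂lebesgueIcc T
      = ENNReal.ofReal (∑ i : Fin n, (τ i.succ - τ i.castSucc) ^ 2 / 6) := by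
  have hmeas : ∀ i : Fin n, Measurable fun t : ℝ =>
      ENNReal.ofReal ((t - τ i.castSucc) * (τ i.succ - t) / (τ i.succ - τ i.castSucc)) := by
    intro i; fun_prop
  rw [lebesgueIcc, lintegral_subtype_comap measurableSet_Icc (condVar τ)]
  unfold condVar
  rw [lintegral_finsetSum _ fun i _ => (hmeas i).indicator measurableSet_Ioc,
    ENNReal.ofReal_sum_of_nonneg fun i _ => by positivity]
  refine Finset.sum_congr rfl fun i _ => ?_
  have hsub : Set.Ioc (τ i.castSucc) (τ i.succ) ⊆ Set.Icc 0 T := fun t ht =>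
    ⟨h0 ▸ (hτ.monotone (Fin.zero_le _)).trans ht.1.le, hn ▸ ht.2.trans (hτ.monotone (Fin.le_last _))⟩
  rw [lintegral_indicator measurableSet_Ioc, Measure.restrict_restrict measurableSet_Ioc,
    Set.inter_eq_left.2 hsub, lintegral_Ioc_mul_sub_div (hτ i.castSucc_lt_succ)]

theorem sum_sub_castSucc {n : ℕ} (τ : Fin (n + 1) → ℝ) :
    ∑ i : Fin n, (τ i.succ - τ i.castSucc) = τ (Fin.last n) - τ 0 := by
  rw [Finset.sum_sub_distrib]
  have h1 := Fin.sum_univ_succ τ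
  have h2 := Fin.sum_univ_castSucc τ
  linarith

/-- Among the partitions of `[0, T]` into `n` intervals the equidistant one minimizes the sum of the
squared lengths. -/
theorem sq_div_le_sum_sq {T : ℝ} {n : ℕ} (hpos : 0 < n) {τ : Fin (n + 1) → ℝ}
    (h0 : τ 0 = 0) (hn : τ (Fin.last n) = T) :
    T ^ 2 / (6 * n) ≤ ∑ i : Fin n, (τ i.succ - τ i.castSucc) ^ 2 / 6 := by
  have hn0 : (0 : ℝ) < n := by exact_mod_cast hpos
  -- Cauchy–Schwarz against the constant `1`; the step lengths telescope to `T`.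
  have h := sq_sum_le_card_mul_sum_sq (s := Finset.univ)
    (f := fun i : Fin n => τ i.succ - τ i.castSucc)
  rw [sum_sub_castSucc, h0, hn, sub_zero, Finset.card_univ, Fintype.card_fin] at h
  rw [← Finset.sum_div, div_le_div_iff₀ (by positivity) (by norm_num)]
  linarith

instance isFiniteMeasure_lebesgueIcc (T : ℝ) : IsFiniteMeasure (lebesgueIcc T) := by
  refine ⟨?_⟩
  rw [lebesgueIcc, (MeasurableEmbedding.subtype_coe measurableSet_Icc).comap_apply]
  exact (measure_mono (Subtype.coe_image_subset _ _)).trans_lt measure_Icc_lt_top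

theorem coe_timePt {T : ℝ} (t : Set.Icc (0 : ℝ) T) : (timePt t : ℝ) = t := rfl

theorem measurable_timePt (T : ℝ) : Measurable (timePt (T := T)) :=
  measurable_subtype_coe.subtype_mk

/-! ### Lower bound at a fixed time. -/

namespace Algorithm

variable {Ω : Type*} [MeasurableSpace Ω] {P : Measure Ω} {T : ℝ} {n : ℕ} {W : ℝ≥0 → Ω → ℝ}

theorem measurable_φ_apply (A : Algorithm T n) (t : Set.Icc (0 : ℝ) T) :
    Measurable fun y => A.φ y t := by
  let _ : MeasurableSpace C(Set.Icc (0 : ℝ) T, ℝ) := borel _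
  have _ : BorelSpace C(Set.Icc (0 : ℝ) T, ℝ) := ⟨rfl⟩
  exact (continuous_eval_const (F := C(Set.Icc (0 : ℝ) T, ℝ)) t).measurable.comp A.measurable_φ

theorem aemeasurable_approx (A : Algorithm T n) (hW : ∀ t, AEMeasurable (W t) P)
    [SFinite P] :
    AEMeasurable (fun p : Ω × Set.Icc (0 : ℝ) T => A.approx W p.1 p.2)
      (P.prod (lebesgueIcc T)) := by
  -- Carathéodory function: continuous in `t`, measurable in `y`.
  have h1 : Measurable (Function.uncurry fun (t : Set.Icc (0 : ℝ) T) y => A.φ y t) :=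
    measurable_uncurry_of_continuous_of_measurable (fun y => (A.φ y).continuous)
      A.measurable_φ_apply
  have h2 : AEMeasurable (A.info W) P := aemeasurable_pi_lambda _ fun i => hW _
  have h3 : AEMeasurable (fun p : Ω × Set.Icc (0 : ℝ) T => (p.2, A.info W p.1))
      (P.prod (lebesgueIcc T)) :=
    measurable_snd.aemeasurable.prodMk
      (h2.comp_quasiMeasurePreserving Measure.quasiMeasurePreserving_fst)
  exact h1.comp_aemeasurable h3

theorem strictMono_coe_node (A : Algorithm T n) : StrictMono fun i => (A.node i : ℝ) :=
  fun _ _ h => A.node_strictMono h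

/-- The mean square error at time `t` is at least the conditional variance of `W t` given the
information. -/
theorem condVar_le [IsProbabilityMeasure P] (A : Algorithm T n) (hW : IsPreBrownianReal W P)
    (t : Set.Icc (0 : ℝ) T) :
    condVar (fun i => (A.node i : ℝ)) t
      ≤ ∫⁻ ω, ‖W (timePt t) ω - A.approx W ω t‖ₑ ^ 2 ∂P := by
  by_cases hex : ∃ k : Fin n, (t : ℝ) ∈ Set.Ioc (A.node k.castSucc : ℝ) (A.node k.succ)
  swap
  · push Not at hex
    rw [condVar, Finset.sum_eq_zero fun k _ => Set.indicator_of_notMem (hex k) _]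
    exact zero_le
  obtain ⟨k, hk⟩ := hex
  rw [condVar_eq_of_mem_Ioc A.strictMono_coe_node k hk]
  set s := timePt (A.node k.castSucc)
  set u := timePt (A.node k.succ)
  have hst : s ≤ timePt t := hk.1.le
  have htu : timePt t ≤ u := hk.2
  have hsu : s < u := hk.1.trans_le hk.2
  -- `G` is the interpolation minus the algorithm's output, so the error is the bridge plus `G` of
  -- the node values. It also takes the value at node `0`, which `info` omits, since `s` may be that
  -- node.
  let G : (Fin (n + 1) → ℝ) → ℝ := fun y =>
    ((timePt t : ℝ) - s) / (u - s) * y k.succ + ((u : ℝ) - timePt t) / (u - s) * y k.castSucc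
      - A.φ (fun i => y i.succ) t
  have hG : Measurable G := by
    have : Measurable fun y : Fin (n + 1) → ℝ => A.φ (fun i => y i.succ) t :=
      (A.measurable_φ_apply t).comp (measurable_pi_lambda _ fun i => measurable_pi_apply _)
    fun_prop
  have hind := (indepFun_bridge hW hst htu hsu (fun j => timePt (A.node j)) fun j => by
    rcases le_or_gt j k.castSucc with h | h
    · exact Or.inl (A.node_strictMono.monotone h)
    · exact Or.inr (A.node_strictMono.monotone (show k.succ ≤ j from h))).comp measurable_id hG
  have hnodes : AEMeasurable (fun ω j => W (timePt (A.node j)) ω) P :=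
    aemeasurable_pi_lambda _ fun j => hW.aemeasurable _
  have := ofReal_integral_sq_le_lintegral_add (memLp_two_bridge hW s u (timePt t))
    (integral_bridge hW s u (timePt t)) (hG.comp_aemeasurable hnodes) hind
  rw [integral_bridge_sq hW hst htu hsu] at this
  refine this.trans_eq (lintegral_congr fun ω => ?_)
  congr 2
  change W (timePt t) ω - (_ * W u ω + _ * W s ω)
    + (_ * W u ω + _ * W s ω - A.approx W ω t) = _
  ring

end Algorithm

/-! ### Errors in `L²(Ω × [0, T])`. -/

section Error

variable {Ω : Type*} [MeasurableSpace Ω] {P : Measure Ω} {T : ℝ} {W : ℝ≥0 → Ω → ℝ}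

/-- The exceptional null set is where `W 0 ≠ 0`: the interpolation has the value `0` built in at the
first node. -/
theorem ae_linearEq_approx (hW : IsPreBrownianReal W P) (hT : 0 < T) (n : ℕ+) :
    ∀ᵐ ω ∂P, ∀ i : Fin n, ∀ t : Set.Icc (0 : ℝ) T,
      (linearEq hT n).node i.castSucc ≤ t → t ≤ (linearEq hT n).node i.succ →
        (linearEq hT n).approx W ω t
          = (((t : ℝ) - (linearEq hT n).node i.castSucc)
                * W (timePt ((linearEq hT n).node i.succ)) ω
              + (((linearEq hT n).node i.succ : ℝ) - t)
                * W (timePt ((linearEq hT n).node i.castSucc)) ω)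
            / (((linearEq hT n).node i.succ : ℝ) - (linearEq hT n).node i.castSucc) := by
  filter_upwards [hW.eval_zero_ae_eq_zero] with ω hω i t h1 h2
  have hcons : ∀ j : Fin (n + 1), (Fin.cons 0 ((linearEq hT n).info W ω) : Fin (n + 1) → ℝ) j
      = W (timePt ((linearEq hT n).node j)) ω := by
    intro j
    refine Fin.cases ?_ (fun j => rfl) j
    have : timePt ((linearEq hT n).node 0) = 0 := NNReal.eq (linearEq hT n).node_zero
    rw [this, hω, Fin.cons_zero]
  have := interp_eq hT n.pos ((linearEq hT n).info W ω) i (t := t) ⟨h1, h2⟩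
  rw [hcons, hcons] at this
  exact this

variable [IsProbabilityMeasure P]

theorem aemeasurable_eval (hW : IsBrownianReal W P) (T : ℝ) :
    AEMeasurable (fun p : Ω × Set.Icc (0 : ℝ) T => W (timePt p.2) p.1)
      (P.prod (lebesgueIcc T)) :=
  aemeasurable_uncurry_of_ae_continuous hW.aemeasurable hW.cont (measurable_timePt T)

/-- Tonelli with time outermost reduces errors to mean squares at a fixed time. -/
theorem eLpNorm_two_prod {f : Ω × Set.Icc (0 : ℝ) T → ℝ}
    (hf : AEMeasurable f (P.prod (lebesgueIcc T))) :
    eLpNorm f 2 (P.prod (lebesgueIcc T))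
      = (∫⁻ t, ∫⁻ ω, ‖f (ω, t)‖ₑ ^ 2 ∂P ∂lebesgueIcc T) ^ (1 / 2 : ℝ) := by
  rw [eLpNorm_eq_lintegral_rpow_enorm_toReal (by norm_num) (by norm_num)]
  simp only [ENNReal.toReal_ofNat, ENNReal.rpow_ofNat]
  rw [lintegral_prod_symm _ (hf.enorm.pow_const 2)]

theorem error_eq (hW : IsBrownianReal W P) (X : Method T) (n : ℕ+) :
    error P W X n = (∫⁻ t, ∫⁻ ω, ‖W (timePt t) ω - (X n).approx W ω t‖ₑ ^ 2 ∂P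
      ∂lebesgueIcc T) ^ (1 / 2 : ℝ) :=
  eLpNorm_two_prod ((aemeasurable_eval hW T).sub ((X n).aemeasurable_approx hW.aemeasurable))

theorem ofReal_rpow_half (hT : 0 < T) (n : ℕ+) :
    ENNReal.ofReal (T ^ 2 / (6 * n)) ^ (1 / 2 : ℝ)
      = ENNReal.ofReal (T / √6 * (n : ℝ) ^ (-(1 / 2) : ℝ)) := by
  have hn : (0 : ℝ) < n := by exact_mod_cast n.pos
  rw [ENNReal.ofReal_rpow_of_nonneg (by positivity) (by norm_num), ← Real.sqrt_eq_rpow,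
    Real.rpow_neg hn.le, ← Real.sqrt_eq_rpow, Real.sqrt_div (by positivity),
    Real.sqrt_sq hT.le, Real.sqrt_mul (by norm_num)]
  congr 1
  field_simp

theorem le_error (hW : IsBrownianReal W P) (hT : 0 < T) (X : Method T) (n : ℕ+) :
    ENNReal.ofReal (T / √6 * (n : ℝ) ^ (-(1 / 2) : ℝ)) ≤ error P W X n := by
  rw [error_eq hW, ← ofReal_rpow_half hT]
  refine ENNReal.rpow_le_rpow ?_ (by norm_num)
  calc ENNReal.ofReal (T ^ 2 / (6 * n))
      ≤ ENNReal.ofReal (∑ i : Fin n,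
        (((X n).node i.succ : ℝ) - (X n).node i.castSucc) ^ 2 / 6) :=
        ENNReal.ofReal_le_ofReal (sq_div_le_sum_sq (τ := fun i => ((X n).node i : ℝ)) n.pos
          (X n).node_zero (X n).node_last)
    _ = ∫⁻ t : Set.Icc (0 : ℝ) T, condVar (fun i => ((X n).node i : ℝ)) t ∂lebesgueIcc T :=
        (lintegral_condVar (X n).strictMono_coe_node (X n).node_zero (X n).node_last).symm
    _ ≤ _ := lintegral_mono fun t => (X n).condVar_le hW.toIsPreBrownianReal t

/-- Equality in `condVar_le`: here the error is exactly the bridge, almost surely. -/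
theorem lintegral_linearEq_sub (hW : IsPreBrownianReal W P) (hT : 0 < T) (n : ℕ+)
    (t : Set.Icc (0 : ℝ) T) :
    ∫⁻ ω, ‖W (timePt t) ω - (linearEq hT n).approx W ω t‖ₑ ^ 2 ∂P
      = condVar (fun i => ((linearEq hT n).node i : ℝ)) t := by
  set A := linearEq hT n with hA
  have key : ∀ k : Fin n, (A.node k.castSucc : ℝ) ≤ t → (t : ℝ) ≤ A.node k.succ →
      ∫⁻ ω, ‖W (timePt t) ω - A.approx W ω t‖ₑ ^ 2 ∂P
        = ENNReal.ofReal (((t : ℝ) - A.node k.castSucc) * (A.node k.succ - t)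
          / (A.node k.succ - A.node k.castSucc)) := by
    intro k h1 h2
    have hlt : A.node k.castSucc < A.node k.succ := A.node_strictMono k.castSucc_lt_succ
    have h := lintegral_enorm_sq_eq_ofReal (memLp_two_bridge hW (timePt (A.node k.castSucc))
      (timePt (A.node k.succ)) (timePt t))
    rw [integral_bridge_sq hW h1 h2 hlt] at h
    refine Eq.trans (lintegral_congr_ae ?_) h
    filter_upwards [ae_linearEq_approx hW hT n] with ω hω
    rw [hω k t h1 h2]
    congr 2
    simp only [bridge, coe_timePt, hA]
    ring
  -- The time `0` lies in no half-open interval of `condVar`; the closed first interval gives `0`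
  -- there as well.
  rcases t.2.1.eq_or_lt with h0 | h0
  · have hk : (A.node (Fin.castSucc ⟨0, n.pos⟩) : ℝ) = 0 := A.node_zero
    rw [key ⟨0, n.pos⟩ (hk.trans h0).le (h0 ▸ (A.node _).2.1), hk, ← h0]
    rw [condVar, Finset.sum_eq_zero fun k _ =>
      Set.indicator_of_notMem (fun h => not_lt.2 (A.node _).2.1 h.1) _]
    simp
  · obtain ⟨k, hk⟩ := exists_mem_Ioc (fun i => (A.node i : ℝ)) (A.node_zero.trans_lt h0)
      (t.2.2.trans_eq A.node_last.symm)
    rw [key k hk.1.le hk.2, condVar_eq_of_mem_Ioc A.strictMono_coe_node k hk]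

theorem error_linearEq (hW : IsBrownianReal W P) (hT : 0 < T) (n : ℕ+) :
    error P W (linearEq hT) n = ENNReal.ofReal (T / √6 * (n : ℝ) ^ (-(1 / 2) : ℝ)) := by
  have hn : (n : ℝ) ≠ 0 := by exact_mod_cast n.pos.ne'
  rw [error_eq hW, ← ofReal_rpow_half hT]
  congr 1
  simp_rw [lintegral_linearEq_sub hW.toIsPreBrownianReal hT n]
  rw [lintegral_condVar (linearEq hT n).strictMono_coe_node (linearEq hT n).node_zero
    (linearEq hT n).node_last]
  congr 1
  have hstep : ∀ i : Fin n,
      (((linearEq hT n).node i.succ : ℝ) - (linearEq hT n).node i.castSucc) = T / n := by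
    intro i
    simp only [linearEq, eqNode, Fin.val_succ, Fin.val_castSucc]
    push_cast
    field_simp
    ring
  simp_rw [hstep]
  rw [Finset.sum_const, Finset.card_univ, Fintype.card_fin, nsmul_eq_mul]
  field_simp

theorem eLpNorm_eval_lt_top (hW : IsBrownianReal W P) (T : ℝ) :
    eLpNorm (fun p : Ω × Set.Icc (0 : ℝ) T => W (timePt p.2) p.1) 2 (P.prod (lebesgueIcc T))
      < ∞ := by
  rw [eLpNorm_two_prod (aemeasurable_eval hW T)]
  refine ENNReal.rpow_lt_top_of_nonneg (by norm_num) (ne_of_lt ?_)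
  have hval : ∀ t : Set.Icc (0 : ℝ) T,
      ∫⁻ ω, ‖W (timePt t) ω‖ₑ ^ 2 ∂P ≤ ENNReal.ofReal T := by
    intro t
    have hB := hW.toIsPreBrownianReal
    rw [lintegral_enorm_sq_eq_ofReal (memLp_two_eval hB _),
      ← variance_of_integral_eq_zero (hB.aemeasurable _) (hB.integral_eval _),
      ← covariance_self (hB.aemeasurable _), hB.covariance_eval, min_self]
    exact ENNReal.ofReal_le_ofReal t.2.2
  refine (lintegral_mono hval).trans_lt ?_
  rw [lintegral_const]
  exact ENNReal.mul_lt_top ENNReal.ofReal_lt_top (measure_lt_top _ _)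

/-- The approximation is `W` minus its error, and both have finite norm. -/
theorem approxNorm_linearEq_lt_top (hW : IsBrownianReal W P) (hT : 0 < T) (n : ℕ+) :
    approxNorm P W (linearEq hT) n < ∞ := by
  have h1 := aemeasurable_eval hW T
  have h2 := (linearEq hT n).aemeasurable_approx hW.aemeasurable
  have h := eLpNorm_sub_le h1.aestronglyMeasurable (h1.sub h2).aestronglyMeasurable
    (p := 2) (by norm_num)
  rw [sub_sub_cancel] at h
  refine h.trans_lt (ENNReal.add_lt_top.2 ⟨eLpNorm_eval_lt_top hW T, ?_⟩)
  exact (error_linearEq hW hT n).trans_lt ENNReal.ofReal_lt_top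

end Error

end WienerRecon

theorem mainTheorem8 {Ω : Type*} [MeasurableSpace Ω] (P : Measure Ω) [IsProbabilityMeasure P]
    (W : ℝ≥0 → Ω → ℝ) (hW : IsBrownianReal W P) (T : ℝ) (hT : 0 < T) :
    (∀ n : ℕ+,
      -- `linearEq` is the piecewise linear interpolation of `W` on the equidistant mesh
      (∀ i : Fin (n + 1), ((WienerRecon.linearEq hT n).node i : ℝ) = i * T / n) ∧
      (∀ᵐ ω ∂P, ∀ i : Fin n, ∀ t : Set.Icc (0 : ℝ) T,
        let tl := (WienerRecon.linearEq hT n).node i.castSucc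
        let tr := (WienerRecon.linearEq hT n).node i.succ
        tl ≤ t → t ≤ tr →
          (WienerRecon.linearEq hT n).approx W ω t
            = (((t : ℝ) - tl) * W (WienerRecon.timePt tr) ω
                + ((tr : ℝ) - t) * W (WienerRecon.timePt tl) ω) / ((tr : ℝ) - tl)) ∧
      -- it is square integrable, its error is exact, and it is optimal among all methods
      WienerRecon.approxNorm P W (WienerRecon.linearEq hT) n < ∞ ∧
      WienerRecon.error P W (WienerRecon.linearEq hT) n
        = ENNReal.ofReal (T / √6 * (n : ℝ) ^ (-(1 / 2) : ℝ)) ∧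
      WienerRecon.error P W (WienerRecon.linearEq hT) n
        = ⨅ X : WienerRecon.Method T, WienerRecon.error P W X n) := by
  intro n
  have herr := WienerRecon.error_linearEq hW hT n
  refine ⟨fun i => rfl, WienerRecon.ae_linearEq_approx hW.toIsPreBrownianReal hT n,
    WienerRecon.approxNorm_linearEq_lt_top hW hT n, herr, ?_⟩
  refine le_antisymm (le_iInf fun X => ?_) (iInf_le _ _)
  rw [herr]
  exact WienerRecon.le_error hW hT X n
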